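/- Let $\mu$ be a finite Borel measure on $\mathbb{C}$ whose support is compact and infinite. Let $\varphi_n$ ($n\ge 0$) be its orthonormal polynomials, obtained by Gram–Schmidt from $1,z,z^2,\dots$ in $L^2(\mu)$, with $\varphi_n$ of degree $n$ and leading coefficient $\kappa_n>0$. Let $M$ be the Bergman shift matrix, that is, the matrix of the operator $f(z)\mapsto zf(z)$ on the closure $\mathcal{P}$ of the polynomials in $L^2(\mu)$ with respect to the orthonormal basis $\{\varphi_n\}_{n\ge0}$ of $\mathcal{P}$, regarded as a bounded operator on $\ell^2(\mathbb{N})$. Let $\mathcal{R}$ and $\mathcal{L}$ be the right and the left shift on $\ell^2(\mathbb{N})$. Assume that \[ \liminf_{n\to\infty}\frac{\kappa_n}{\kappa_{n+1}}>0 . \] Then the following are equivalent: (a) There exist a real number $R>0$ and a function $f$ analytic in $\{z: R<|z|\le\infty\}$ (the point $\infty$ of the Riemann sphere included) such that \[ \lim_{n\to\infty}\frac{\varphi_n(z)}{\varphi_{n+1}(z)}=f(z)\qquad\text{for every } z \text{ with } R<|z|\le\infty . \] (b) $M$ is weakly asymptotically Toeplitz: there is a bounded Toeplitz operator $T$ on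 $\ell^2(\mathbb{N})$ (one whose matrix entries $T_{i,j}$ depend only on $j-i$) such that $\mathcal{L}^nM\mathcal{R}^n$ converges to $T$ in the weak operator topology as $n\to\infty$. -/

import Mathlib

open MeasureTheory Filter Topology Polynomial
open scoped ENNReal ComplexConjugate InnerProductSpace

noncomputable section

namespace OrthPoly

/-! ### Orthogonal polynomials of a measure on the plane -/

/-- The monic orthogonal polynomials `Φ_n` of `μ`: Gram-Schmidt orthogonalization of
`1, z, z², …` with respect to the inner product of `L²(μ)`. -/
def monicPoly (μ : Measure ℂ) (n : ℕ) : ℂ[X] :=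
  X ^ n - ∑ k : Fin n,
    C ((∫ z, conj ((monicPoly μ k).eval z) * z ^ n ∂μ) /
      (∫ z, ‖(monicPoly μ k).eval z‖ ^ 2 ∂μ : ℝ)) * monicPoly μ k
termination_by n
decreasing_by all_goals exact k.2

/-- `κ_n = 1 / ‖Φ_n‖`, the norm being that of `L²(μ)`; it is the leading coefficient of `φ_n`. -/
def kappa (μ : Measure ℂ) (n : ℕ) : ℝ :=
  (√(∫ z, ‖(monicPoly μ n).eval z‖ ^ 2 ∂μ))⁻¹

/-- The orthonormal polynomials `φ_n = κ_n Φ_n` of `μ`. -/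
def orthoPoly (μ : Measure ℂ) (n : ℕ) : ℂ[X] :=
  C (kappa μ n : ℂ) * monicPoly μ n

lemma monicPoly_eq (μ : Measure ℂ) (n : ℕ) :
    monicPoly μ n = X ^ n - ∑ k ∈ Finset.Iio n,
      C ((∫ z, conj ((monicPoly μ k).eval z) * z ^ n ∂μ) /
        (∫ z, ‖(monicPoly μ k).eval z‖ ^ 2 ∂μ : ℝ)) * monicPoly μ k := by
  rw [monicPoly]
  congr 1
  rw [Nat.Iio_eq_range]
  exact Fin.sum_univ_eq_sum_range (fun k : ℕ =>
      C ((∫ z, conj ((monicPoly μ k).eval z) * z ^ n ∂μ) /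
        (∫ z, ‖(monicPoly μ k).eval z‖ ^ 2 ∂μ : ℝ)) * monicPoly μ k) n

lemma monic_monicPoly (μ : Measure ℂ) (n : ℕ) :
    (monicPoly μ n).Monic ∧ (monicPoly μ n).natDegree = n := by
  induction n using Nat.strong_induction_on with
  | _ n ih =>
    have hlt : (∑ k ∈ Finset.Iio n,
        C ((∫ z, conj ((monicPoly μ k).eval z) * z ^ n ∂μ) /
          (∫ z, ‖(monicPoly μ k).eval z‖ ^ 2 ∂μ : ℝ)) * monicPoly μ k).degree
        < ((n : ℕ) : WithBot ℕ) := by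
      refine lt_of_le_of_lt (degree_sum_le _ _) ((Finset.sup_lt_iff (WithBot.bot_lt_coe n)).2 ?_)
      intro k hk
      have hk' : k < n := Finset.mem_Iio.1 hk
      refine lt_of_le_of_lt degree_le_natDegree ?_
      refine lt_of_le_of_lt (Nat.cast_le.2 (natDegree_C_mul_le _ _)) ?_
      rw [(ih k hk').2]
      exact Nat.cast_lt.2 hk'
    rw [monicPoly_eq]
    refine ⟨monic_X_pow_sub hlt, ?_⟩
    rw [← degree_X_pow (R := ℂ) n] at hlt
    apply natDegree_eq_of_degree_eq_some
    rw [degree_sub_eq_left_of_degree_lt hlt, degree_X_pow]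

/-- `κ_n` is the leading coefficient of `φ_n`. -/
lemma leadingCoeff_orthoPoly (μ : Measure ℂ) (n : ℕ) :
    (orthoPoly μ n).leadingCoeff = kappa μ n := by
  rw [orthoPoly, leadingCoeff_mul, (monic_monicPoly μ n).1, leadingCoeff_C, mul_one]

/-! ### The Bergman shift -/

section Shift

variable {μ : Measure ℂ} [IsFiniteMeasure μ]

lemma memLp_of_continuous (hc : IsCompact μ.support) {g : ℂ → ℂ} (hg : Continuous g) (p : ℝ≥0∞) :
    MemLp g p μ := by
  obtain ⟨B, hB⟩ := hc.exists_bound_of_continuousOn hg.continuousOn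
  refine MemLp.of_bound hg.aestronglyMeasurable B ?_
  filter_upwards [Measure.support_mem_ae (μ := μ)] with x hx using hB x hx

/-- The class of a polynomial in `L²(μ)`. -/
def polyLp (hc : IsCompact μ.support) : ℂ[X] →ₗ[ℂ] Lp ℂ 2 μ where
  toFun p := (memLp_of_continuous hc p.continuous 2).toLp (fun z => p.eval z)
  map_add' p q := by
    rw [← MemLp.toLp_add]
    exact MemLp.toLp_congr _ _ (ae_of_all _ fun z => by simp)
  map_smul' c p := by
    rw [RingHom.id_apply, ← MemLp.toLp_const_smul]
    exact MemLp.toLp_congr _ _ (ae_of_all _ fun z => by simp)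

lemma coeFn_polyLp (hc : IsCompact μ.support) (p : ℂ[X]) :
    polyLp hc p =ᵐ[μ] fun z => p.eval z :=
  MemLp.coeFn_toLp (memLp_of_continuous hc p.continuous 2)

/-- `𝒫`: the closure of the polynomials in `L²(μ)`. -/
def polySpace (hc : IsCompact μ.support) : Submodule ℂ (Lp ℂ 2 μ) :=
  (LinearMap.range (polyLp hc)).topologicalClosure

/-- Multiplication by `z` on `L²(μ)`. -/
def mulZ (hc : IsCompact μ.support) : Lp ℂ 2 μ →L[ℂ] Lp ℂ 2 μ :=
  (ContinuousLinearMap.mul ℂ ℂ).holderL μ ∞ 2 2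
    ((memLp_of_continuous hc continuous_id ∞).toLp (fun z : ℂ => z))

lemma coeFn_mulZ (hc : IsCompact μ.support) (f : Lp ℂ 2 μ) :
    mulZ hc f =ᵐ[μ] fun z => z * f z := by
  have h1 := (ContinuousLinearMap.mul ℂ ℂ).coeFn_holder (r := 2)
    ((memLp_of_continuous hc continuous_id ∞).toLp (fun z : ℂ => z)) f
  have h2 := MemLp.coeFn_toLp (memLp_of_continuous hc continuous_id ∞)
  filter_upwards [h1, h2] with z hz1 hz2
  refine hz1.trans ?_
  rw [ContinuousLinearMap.mul_apply']
  exact congrArg (· * f z) hz2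

lemma mulZ_polyLp (hc : IsCompact μ.support) (p : ℂ[X]) :
    mulZ hc (polyLp hc p) = polyLp hc (X * p) := by
  apply Lp.ext
  filter_upwards [coeFn_mulZ hc (polyLp hc p), coeFn_polyLp hc p, coeFn_polyLp hc (X * p)]
    with z h1 h2 h3
  rw [h1, h2, h3, eval_mul, eval_X]

lemma mulZ_mem (hc : IsCompact μ.support) (f : Lp ℂ 2 μ) (hf : f ∈ polySpace hc) :
    mulZ hc f ∈ polySpace hc := by
  have hsub : Set.MapsTo (mulZ hc) (LinearMap.range (polyLp hc) : Set (Lp ℂ 2 μ))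
      (LinearMap.range (polyLp hc)) := by
    rintro _ ⟨p, rfl⟩
    exact ⟨X * p, (mulZ_polyLp hc p).symm⟩
  exact hsub.closure (mulZ hc).continuous hf

/-- The restriction of multiplication by `z` to `𝒫`. -/
def mulZRestrict (hc : IsCompact μ.support) : polySpace hc →L[ℂ] polySpace hc :=
  (mulZ hc ∘L (polySpace hc).subtypeL).codRestrict (polySpace hc)
    fun f => mulZ_mem hc f f.2

lemma inner_polyLp (hc : IsCompact μ.support) (p q : ℂ[X]) :
    ⟪polyLp hc p, polyLp hc q⟫_ℂ = ∫ z, conj (p.eval z) * q.eval z ∂μ := by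
  rw [L2.inner_def]
  apply integral_congr_ae
  filter_upwards [coeFn_polyLp hc p, coeFn_polyLp hc q] with z h1 h2
  rw [h1, h2, RCLike.inner_apply, mul_comm]

lemma norm_sq_polyLp (hc : IsCompact μ.support) (p : ℂ[X]) :
    ‖polyLp hc p‖ ^ 2 = ∫ z, ‖p.eval z‖ ^ 2 ∂μ := by
  have h := inner_polyLp hc p p
  rw [inner_self_eq_norm_sq_to_K] at h
  have h2 : (∫ z, conj (p.eval z) * p.eval z ∂μ) = ((∫ z, ‖p.eval z‖ ^ 2 ∂μ : ℝ) : ℂ) := by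
    rw [← integral_complex_ofReal]
    congr 1
    ext z
    rw [mul_comm, Complex.mul_conj, Complex.normSq_eq_norm_sq]
  rw [h2] at h
  apply Complex.ofReal_injective
  rw [← h]
  push_cast
  rfl

lemma polyLp_injective (hc : IsCompact μ.support) (hinf : μ.support.Infinite) :
    Function.Injective (polyLp hc) := by
  rw [injective_iff_map_eq_zero]
  intro p hp
  by_contra hne
  apply hinf
  refine (p.rootSet_finite ℂ).subset ?_
  intro z hz
  rw [mem_rootSet_of_ne hne, coe_aeval_eq_eval]
  by_contra hpz
  have hae : ∀ᵐ w ∂μ, p.eval w = 0 := by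
    have h1 := coeFn_polyLp hc p
    rw [hp] at h1
    filter_upwards [h1, Lp.coeFn_zero ℂ 2 μ] with w h2 h3
    rw [← h2, h3]; rfl
  have hU : {w | p.eval w ≠ 0} ∈ 𝓝 z :=
    (isOpen_ne_fun p.continuous continuous_const).mem_nhds hpz
  exact ((Measure.mem_support_iff_forall z).1 hz _ hU).ne' hae

lemma polyLp_monicPoly (hc : IsCompact μ.support) (n : ℕ) :
    polyLp hc (monicPoly μ n)
      = InnerProductSpace.gramSchmidt ℂ (fun k : ℕ => polyLp hc (X ^ k)) n := by
  induction n using Nat.strong_induction_on with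
  | _ n ih =>
    have h := InnerProductSpace.gramSchmidt_def'' ℂ (fun k : ℕ => polyLp hc (X ^ k)) n
    rw [← sub_eq_iff_eq_add] at h
    rw [← h, monicPoly_eq, map_sub, map_sum]
    congr 1
    refine Finset.sum_congr rfl fun k hk => ?_
    rw [← ih k (Finset.mem_Iio.1 hk), C_mul', map_smul, inner_polyLp, ← norm_sq_polyLp hc]
    simp

lemma polyLp_orthoPoly (hc : IsCompact μ.support) (n : ℕ) :
    polyLp hc (orthoPoly μ n)
      = InnerProductSpace.gramSchmidtNormed ℂ (fun k : ℕ => polyLp hc (X ^ k)) n := by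
  rw [InnerProductSpace.gramSchmidtNormed, ← polyLp_monicPoly hc, orthoPoly, C_mul', map_smul,
    kappa, ← norm_sq_polyLp hc, Real.sqrt_sq (norm_nonneg _)]
  simp

lemma orthonormal_orthoPoly (hc : IsCompact μ.support) (hinf : μ.support.Infinite) :
    Orthonormal ℂ fun n => polyLp hc (orthoPoly μ n) := by
  simp_rw [polyLp_orthoPoly hc]
  apply InnerProductSpace.gramSchmidtNormed_orthonormal
  have h : LinearIndependent ℂ (polyLp hc ∘ basisMonomials ℂ) :=
    (basisMonomials ℂ).linearIndependent.map' (polyLp hc)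
      (LinearMap.ker_eq_bot.2 (polyLp_injective hc hinf))
  have he : (polyLp hc ∘ basisMonomials ℂ) = fun k : ℕ => polyLp hc (X ^ k) := by
    ext1 k
    simp [X_pow_eq_monomial]
  rwa [he] at h

lemma span_orthoPoly (hc : IsCompact μ.support) :
    Submodule.span ℂ (Set.range fun n => polyLp hc (orthoPoly μ n))
      = LinearMap.range (polyLp hc) := by
  simp_rw [polyLp_orthoPoly hc]
  rw [InnerProductSpace.span_gramSchmidtNormed_range, InnerProductSpace.span_gramSchmidt,
    LinearMap.range_eq_map, ← (basisMonomials ℂ).span_eq, Submodule.map_span, ← Set.range_comp]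
  congr 2
  ext k
  simp [X_pow_eq_monomial]

/-- `φ_n` as an element of `𝒫`. -/
def orthoVec (hc : IsCompact μ.support) (n : ℕ) : polySpace hc :=
  ⟨polyLp hc (orthoPoly μ n), Submodule.le_topologicalClosure _ ⟨_, rfl⟩⟩

lemma orthonormal_orthoVec (hc : IsCompact μ.support) (hinf : μ.support.Infinite) :
    Orthonormal ℂ (orthoVec hc) :=
  (orthonormal_orthoPoly hc hinf).codRestrict (polySpace hc) fun n => (orthoVec hc n).2

lemma dense_orthoVec (hc : IsCompact μ.support) :
    ⊤ ≤ (Submodule.span ℂ (Set.range (orthoVec hc))).topologicalClosure := by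
  intro f _
  change f ∈ closure ((Submodule.span ℂ (Set.range (orthoVec hc)) : Submodule ℂ (polySpace hc)) :
    Set (polySpace hc))
  rw [closure_subtype]
  have h : (Subtype.val '' ((Submodule.span ℂ (Set.range (orthoVec hc)) :
      Submodule ℂ (polySpace hc)) : Set (polySpace hc)))
      = (LinearMap.range (polyLp hc) : Set (Lp ℂ 2 μ)) := by
    rw [← span_orthoPoly hc]
    have := Submodule.map_span (polySpace hc).subtype (Set.range (orthoVec hc))
    rw [← Set.range_comp] at this
    exact congrArg (fun S : Submodule ℂ (Lp ℂ 2 μ) => (S : Set (Lp ℂ 2 μ))) this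
  rw [h]
  exact f.2

instance (hc : IsCompact μ.support) : CompleteSpace (polySpace hc) :=
  (Submodule.isClosed_topologicalClosure _).completeSpace_coe

/-- The orthonormal polynomials as an orthonormal (Hilbert) basis of `𝒫`. -/
def orthoBasis (hc : IsCompact μ.support) (hinf : μ.support.Infinite) :
    HilbertBasis ℕ ℂ (polySpace hc) :=
  HilbertBasis.mk (orthonormal_orthoVec hc hinf) (dense_orthoVec hc)

/-- `ℓ²(ℕ)`, indexed from `0`. -/
abbrev EllTwo : Type := lp (fun _ : ℕ => ℂ) 2

/-- The Bergman shift matrix `M`, as an operator on `ℓ²`: multiplication by `z` on `𝒫`, written in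
the orthonormal basis `φ_0, φ_1, …`. -/
def bergmanShift (hc : IsCompact μ.support) (hinf : μ.support.Infinite) : EllTwo →L[ℂ] EllTwo :=
  ((orthoBasis hc hinf).repr : polySpace hc →L[ℂ] EllTwo) ∘L mulZRestrict hc ∘L
    ((orthoBasis hc hinf).repr.symm : EllTwo →L[ℂ] polySpace hc)

end Shift

/-! ### Shifts on `ℓ²`, Toeplitz operators, weak convergence -/

/-- The standard basis vector `e_n` of `ℓ²`. -/
def stdVec (n : ℕ) : EllTwo := lp.single 2 n (1 : ℂ)

/-- The matrix entry `⟨e_i, A e_j⟩` of an operator on `ℓ²` (row `i`, column `j`, from `0`). -/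
def entry (A : EllTwo →L[ℂ] EllTwo) (i j : ℕ) : ℂ := ⟪stdVec i, A (stdVec j)⟫_ℂ

lemma entry_bergmanShift {μ : Measure ℂ} [IsFiniteMeasure μ] (hc : IsCompact μ.support)
    (hinf : μ.support.Infinite) (i j : ℕ) :
    entry (bergmanShift hc hinf) i j
      = ∫ z, conj ((orthoPoly μ i).eval z) * (z * (orthoPoly μ j).eval z) ∂μ := by
  have hs : ∀ n, (orthoBasis hc hinf).repr.symm (stdVec n) = orthoVec hc n := fun n => by
    rw [stdVec, HilbertBasis.repr_symm_single, orthoBasis, HilbertBasis.coe_mk]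
  have h1 : entry (bergmanShift hc hinf) i j
      = ⟪orthoVec hc i, mulZRestrict hc (orthoVec hc j)⟫_ℂ := by
    rw [← hs i, ← hs j, ← LinearIsometryEquiv.inner_map_map (orthoBasis hc hinf).repr,
      LinearIsometryEquiv.apply_symm_apply]
    rfl
  rw [h1]
  change ⟪polyLp hc (orthoPoly μ i), mulZ hc (polyLp hc (orthoPoly μ j))⟫_ℂ = _
  rw [mulZ_polyLp, inner_polyLp]
  simp

lemma norm_sq_ellTwo (a : EllTwo) : ‖a‖ ^ 2 = ∑' n, ‖a n‖ ^ 2 := by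
  have h := lp.norm_rpow_eq_tsum (p := 2) (by norm_num) a
  simpa using h

lemma summable_ellTwo (a : EllTwo) : Summable fun n => ‖a n‖ ^ 2 := by
  simpa using (lp.memℓp a).summable (by norm_num)

lemma memℓp_two {a : ℕ → ℂ} (h : Summable fun n => ‖a n‖ ^ 2) : Memℓp a 2 :=
  memℓp_gen (by simpa using h)

/-- The right shift of a sequence, `(a_0, a_1, …) ↦ (0, a_0, a_1, …)`. -/
def shiftSeq (a : ℕ → ℂ) : ℕ → ℂ
  | 0 => 0
  | n + 1 => a n

lemma summable_shiftSeq (a : EllTwo) : Summable fun n => ‖shiftSeq a n‖ ^ 2 := by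
  rw [← summable_nat_add_iff 1]
  exact summable_ellTwo a

lemma tsum_shiftSeq (a : EllTwo) : ∑' n, ‖shiftSeq a n‖ ^ 2 = ∑' n, ‖a n‖ ^ 2 := by
  rw [(summable_shiftSeq a).tsum_eq_zero_add]
  simp [shiftSeq]

/-- The right shift on `ℓ²`. -/
def shiftR : EllTwo →L[ℂ] EllTwo :=
  LinearMap.mkContinuous
    { toFun := fun a => ⟨shiftSeq a, memℓp_two (summable_shiftSeq a)⟩
      map_add' := fun a b => by
        ext n
        cases n with
        | zero => exact (add_zero (0 : ℂ)).symm
        | succ m => rfl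
      map_smul' := fun c a => by
        ext n
        cases n with
        | zero => exact (mul_zero c).symm
        | succ m => rfl } 1 fun a => by
    rw [one_mul]
    refine (sq_le_sq₀ (norm_nonneg _) (norm_nonneg _)).1 ?_
    rw [norm_sq_ellTwo, norm_sq_ellTwo]
    exact (tsum_shiftSeq a).le

/-- The left shift on `ℓ²`, `(a_0, a_1, …) ↦ (a_1, a_2, …)`. -/
def shiftL : EllTwo →L[ℂ] EllTwo :=
  LinearMap.mkContinuous
    { toFun := fun a => ⟨fun n => a (n + 1),
        memℓp_two ((summable_nat_add_iff 1).2 (summable_ellTwo a))⟩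
      map_add' := fun a b => rfl
      map_smul' := fun c a => rfl } 1 fun a => by
    rw [one_mul]
    refine (sq_le_sq₀ (norm_nonneg _) (norm_nonneg _)).1 ?_
    rw [norm_sq_ellTwo, norm_sq_ellTwo, Summable.tsum_eq_zero_add (summable_ellTwo a)]
    exact le_add_of_nonneg_left (sq_nonneg _)

/-- `T` is a Toeplitz operator: its matrix is constant along diagonals, `T_{ij} = a_{j-i}`. -/
def IsToeplitz (T : EllTwo →L[ℂ] EllTwo) : Prop :=
  ∃ a : ℤ → ℂ, ∀ i j : ℕ, entry T i j = a ((j : ℤ) - i)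

/-- `A` is weakly asymptotically Toeplitz: `L^n A R^n` converges, in the weak operator topology,
to a Toeplitz operator. -/
def IsWeaklyAsymptoticallyToeplitz (A : EllTwo →L[ℂ] EllTwo) : Prop :=
  ∃ T : EllTwo →L[ℂ] EllTwo, IsToeplitz T ∧
    Tendsto (fun n : ℕ => ContinuousLinearMapWOT.ofCLM ((shiftL ^ n) ∘L A ∘L (shiftR ^ n))) atTop
      (𝓝 (ContinuousLinearMapWOT.ofCLM T))

/-! ### Ratio asymptotics near infinity -/

/-- The part `R < |z| ≤ ∞` of the Riemann sphere. -/
def nearInfty (R : ℝ) : Set (OnePoint ℂ) :=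
  {OnePoint.infty} ∪ (fun z : ℂ => (z : OnePoint ℂ)) '' {z : ℂ | R < ‖z‖}

/-- `f` is analytic in `R < |z| ≤ ∞`: it is analytic at every finite point, and in the chart
`w = 1/z` it is analytic at the point `w = 0`, i.e. `z = ∞`. -/
def IsAnalyticNearInfty (R : ℝ) (f : OnePoint ℂ → ℂ) : Prop :=
  AnalyticOnNhd ℂ (fun z : ℂ => f z) {z : ℂ | R < ‖z‖} ∧
    AnalyticAt ℂ (fun w : ℂ => if w = 0 then f OnePoint.infty else f (w⁻¹ : ℂ)) 0

/-- The value of the rational function `p / q` at a point of the Riemann sphere; at `∞` it is the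
limit of `p(z) / q(z)` as `|z| → ∞`. -/
def ratioAt (p q : ℂ[X]) : OnePoint ℂ → ℂ
  | OnePoint.infty => limUnder (Bornology.cobounded ℂ) fun z => p.eval z / q.eval z
  | OnePoint.some z => p.eval z / q.eval z

/-- The value at `∞` of `p / q` when `deg p < deg q`. -/
lemma ratioAt_infty {p q : ℂ[X]} (h : p.degree < q.degree) :
    ratioAt p q OnePoint.infty = 0 :=
  (isLittleO_cobounded_of_degree_lt h).tendsto_div_nhds_zero.limUnder_eq

/-- The orthonormal polynomials have ratio asymptotics near `∞`. -/
def HasRatioAsymptotics (μ : Measure ℂ) : Prop :=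
  ∃ R : ℝ, 0 < R ∧ ∃ f : OnePoint ℂ → ℂ, IsAnalyticNearInfty R f ∧
    ∀ z ∈ nearInfty R,
      Tendsto (fun n : ℕ => ratioAt (orthoPoly μ n) (orthoPoly μ (n + 1)) z) atTop (𝓝 (f z))

end OrthPoly

end

open OrthPoly

namespace OrthPoly

/-! ### Sequences of ratios satisfying a long recurrence -/

/-! Since `z φ_n` has degree `n + 1`, the matrix `M` is Hessenberg. Dividing the expansion of `z
φ_n` by `φ_{n+1}` gives, for the ratios `r_n = φ_n(z)/φ_{n+1}(z)`, `z r_n = ∑_k d_k(n) r_n r_{n-1} ⋯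
r_{n-k+1}`, with `d_k(n) = M_{n+1-k,n}`. The `d_k` are the diagonals of `M`. Because the operators
`L^n M R^n` are uniformly bounded, weak convergence to a Toeplitz operator amounts to convergence of
every `d_k` (`isWeaklyAsymptoticallyToeplitz_iff`). The theorem thus says that the solutions of the
recurrence converge near infinity exactly when its coefficients do.

Put `B = ‖M‖`. For `|z| ≥ 4B` the values `φ_n(z)` at least double in modulus (`hessenberg_growth`),
so `|r_n| ≤ 1/2`, the series has a geometric tail, and in fact `|r_n| ≤ 2B/|z|`.

From ratios to coefficients (`exists_tendsto_coeff`): by induction on `k`, solve the recurrence for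
`d_k(n)`. The neglected tail is of order `|z|^{-(k+1)}`, and the divisor, a product of `k` ratios,
is at least of order `|z|^{-k}` because `d_0(n) = κ_n/κ_{n+1}` is bounded below. The error therefore
vanishes as `|z| → ∞`.

From coefficients to ratios (`uniformCauchySeqOn`): for `|z| ≥ 8B` the recurrence contracts the
oscillation of `r_n` by the factor `3/4`. The uniform limit is analytic and `O(1/|z|)`, so its
singularity at infinity is removable, with value `0`. -/

lemma norm_sub_sum_range_le {f : ℕ → ℂ} {a : ℂ} {B ρ : ℝ} (hB : 0 ≤ B) (hρ : 0 ≤ ρ)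
    (hρ' : ρ ≤ 1 / 2) (hf : HasSum f a) (hb : ∀ k, ‖f k‖ ≤ B * ρ ^ k) (K : ℕ) :
    ‖a - ∑ k ∈ Finset.range K, f k‖ ≤ 2 * B * ρ ^ K := by
  have h1 := (hasSum_nat_add_iff' K).2 hf
  have h2 : HasSum (fun k : ℕ => B * ρ ^ K * ρ ^ k) (B * ρ ^ K * (1 - ρ)⁻¹) :=
    (hasSum_geometric_of_lt_one hρ (by linarith)).mul_left _
  refine (h1.norm_le_of_bounded h2 fun k => (hb _).trans_eq (by ring)).trans ?_
  have h3 : (1 - ρ)⁻¹ ≤ 2 := by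
    rw [inv_le_comm₀ (by linarith) two_pos]; linarith
  calc B * ρ ^ K * (1 - ρ)⁻¹ ≤ B * ρ ^ K * 2 := by gcongr
    _ = _ := by ring

/-- Exchanging the factors one at a time costs `ε (1/2)^(k-1)` for each of the `k` factors. -/
lemma norm_prod_sub_prod_le {a b : ℕ → ℂ} {ε : ℝ} {k : ℕ} (ha : ∀ i < k, ‖a i‖ ≤ 1 / 2)
    (hb : ∀ i < k, ‖b i‖ ≤ 1 / 2) (hab : ∀ i < k, ‖a i - b i‖ ≤ ε) :
    ‖∏ i ∈ Finset.range k, a i - ∏ i ∈ Finset.range k, b i‖ ≤ 2 * (k * (1 / 2) ^ k) * ε := by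
  induction k with
  | zero => simp
  | succ k ih =>
    have ih' := ih (fun i hi => ha i (hi.trans k.lt_succ_self))
      (fun i hi => hb i (hi.trans k.lt_succ_self)) (fun i hi => hab i (hi.trans k.lt_succ_self))
    have h1 : ‖∏ i ∈ Finset.range k, a i‖ ≤ (1 / 2) ^ k := by
      rw [norm_prod]
      refine (Finset.prod_le_prod (fun i _ => norm_nonneg _) fun i hi =>
        ha i ((Finset.mem_range.1 hi).trans k.lt_succ_self)).trans_eq (by simp)
    rw [Finset.prod_range_succ, Finset.prod_range_succ]
    have h0 : 0 ≤ ε := (norm_nonneg _).trans (hab k k.lt_succ_self)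
    calc _ = ‖(∏ i ∈ Finset.range k, a i) * (a k - b k)
          + (∏ i ∈ Finset.range k, a i - ∏ i ∈ Finset.range k, b i) * b k‖ := by ring_nf
      _ ≤ (1 / 2) ^ k * ε + 2 * (k * (1 / 2) ^ k) * ε * (1 / 2) := by
          refine (norm_add_le _ _).trans ?_
          rw [norm_mul, norm_mul]
          gcongr
          · exact hab k k.lt_succ_self
          · exact hb k k.lt_succ_self
      _ = _ := by push_cast; ring

lemma sum_mul_half_pow_le (K : ℕ) : ∑ k ∈ Finset.range K, (k : ℝ) * (1 / 2) ^ k ≤ 2 := by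
  have h : ∑ k ∈ Finset.range K, (k : ℝ) * (1 / 2) ^ k = 2 - 2 * (K + 1) * (1 / 2) ^ K := by
    induction K with
    | zero => simp
    | succ K ih => rw [Finset.sum_range_succ, ih]; push_cast; ring
  rw [h]
  have : (0 : ℝ) ≤ 2 * (K + 1) * (1 / 2) ^ K := by positivity
  linarith

/-- The approximating sequence and its limit may change with `ε`, so the limit of `u` need not be
identified. -/
lemma cauchySeq_of_approx {u : ℕ → ℂ}
    (h : ∀ ε > 0, ∃ v : ℕ → ℂ, (∃ a, Tendsto v atTop (𝓝 a)) ∧ ∀ᶠ n in atTop, ‖u n - v n‖ ≤ ε) :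
    CauchySeq u := by
  rw [Metric.cauchySeq_iff']
  intro ε hε
  obtain ⟨v, ⟨a, hv⟩, huv⟩ := h (ε / 8) (by positivity)
  have hva : ∀ᶠ n in atTop, ‖v n - a‖ < ε / 8 := by
    simpa [dist_eq_norm] using (Metric.tendsto_nhds.1 hv) (ε / 8) (by positivity)
  obtain ⟨N, hN⟩ := eventually_atTop.1 (huv.and hva)
  refine ⟨N, fun n hn => ?_⟩
  obtain ⟨h1, h2⟩ := hN n hn
  obtain ⟨h3, h4⟩ := hN N le_rfl
  rw [dist_eq_norm]
  calc ‖u n - u N‖ = ‖(u n - v n) + (v n - a) - ((u N - v N) + (v N - a))‖ := by ring_nf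
    _ ≤ (‖u n - v n‖ + ‖v n - a‖) + (‖u N - v N‖ + ‖v N - a‖) :=
        (norm_sub_le _ _).trans (add_le_add (norm_add_le _ _) (norm_add_le _ _))
    _ < ε := by linarith

/-! ### The long recurrence: solutions and coefficients determine each other's convergence -/

/-- The sequence `r` solves the long recurrence with coefficients `d` at the point `z`. -/
def SolvesRecurrence (d : ℕ → ℕ → ℂ) (z : ℂ) (r : ℕ → ℂ) : Prop :=
  ∀ n, HasSum (fun k => d k n * ∏ i ∈ Finset.range k, r (n - i)) (z * r n)

lemma norm_prod_shift_le {r : ℕ → ℂ} {ρ : ℝ} (hr : ∀ n, ‖r n‖ ≤ ρ) (n k : ℕ) :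
    ‖∏ i ∈ Finset.range k, r (n - i)‖ ≤ ρ ^ k := by
  rw [norm_prod]
  exact (Finset.prod_le_prod (fun i _ => norm_nonneg _) fun i _ => hr _).trans_eq (by simp)

namespace SolvesRecurrence

variable {d : ℕ → ℕ → ℂ} {z : ℂ} {r : ℕ → ℂ} {B ρ : ℝ}

lemma norm_sub_sum_le (h : SolvesRecurrence d z r) (hd : ∀ k n, ‖d k n‖ ≤ B) (hρ' : ρ ≤ 1 / 2)
    (hr : ∀ n, ‖r n‖ ≤ ρ) (n K : ℕ) :
    ‖z * r n - ∑ k ∈ Finset.range K, d k n * ∏ i ∈ Finset.range k, r (n - i)‖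
      ≤ 2 * B * ρ ^ K := by
  have hB : 0 ≤ B := (norm_nonneg _).trans (hd 0 0)
  have hρ : 0 ≤ ρ := (norm_nonneg _).trans (hr 0)
  refine norm_sub_sum_range_le hB hρ hρ' (h n) (fun k => ?_) K
  rw [norm_mul]
  exact mul_le_mul (hd k n) (norm_prod_shift_le hr n k) (norm_nonneg _) hB

/-- The tail estimate with no term removed. It upgrades the a priori bound `1/2` to decay of order
`1/‖z‖`. -/
lemma norm_mul_le (h : SolvesRecurrence d z r) (hd : ∀ k n, ‖d k n‖ ≤ B)
    (hr : ∀ n, ‖r n‖ ≤ 1 / 2) (n : ℕ) : ‖z‖ * ‖r n‖ ≤ 2 * B := by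
  have h1 := h.norm_sub_sum_le hd le_rfl hr n 0
  simpa using h1

/-- Convergence of the solutions forces convergence of the coefficients. -/
lemma exists_tendsto_coeff {r : ℂ → ℕ → ℂ} {c R : ℝ} (hB : 0 < B) (hc : 0 < c)
    (hd : ∀ k n, ‖d k n‖ ≤ B) (hd0 : ∀ᶠ n in atTop, c ≤ ‖d 0 n‖)
    (h : ∀ z, R ≤ ‖z‖ → SolvesRecurrence d z (r z))
    (hr : ∀ z, R ≤ ‖z‖ → ∀ n, ‖r z n‖ ≤ 1 / 2)
    (hlim : ∀ z, R ≤ ‖z‖ → ∃ a, Tendsto (r z) atTop (𝓝 a)) (k : ℕ) :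
    ∃ a, Tendsto (d k) atTop (𝓝 a) := by
  induction k using Nat.strong_induction_on with
  | _ k ih =>
    apply cauchySeq_tendsto_of_complete
    apply cauchySeq_of_approx
    intro ε hε
    -- With this `γ`, the condition `ρ ≤ γ` makes the tail after the zeroth term at most `c / 2`,
    -- and then `‖r z n‖ ≥ γ * ρ`.
    set γ : ℝ := c / (4 * B) with hγ
    have hγ0 : 0 < γ := by positivity
    obtain ⟨ρ, hρ0, hρ1, hρ2, hρ3, hρ4⟩ : ∃ ρ : ℝ, 0 < ρ ∧ ρ ≤ 1 / 2 ∧ ρ ≤ γ ∧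
        2 * B * ρ / γ ^ k ≤ ε ∧ R ≤ 2 * B / ρ := by
      have t1 : Tendsto (fun ρ : ℝ => 2 * B * ρ / γ ^ k) (𝓝[>] 0) (𝓝 0) := by
        have : Continuous fun ρ : ℝ => 2 * B * ρ / γ ^ k := by fun_prop
        simpa using (this.tendsto 0).mono_left nhdsWithin_le_nhds
      have t2 : Tendsto (fun ρ : ℝ => 2 * B / ρ) (𝓝[>] 0) atTop :=
        tendsto_inv_nhdsGT_zero.const_mul_atTop (by positivity : 0 < 2 * B)
      have t3 : Tendsto (fun ρ : ℝ => ρ) (𝓝[>] 0) (𝓝 0) := nhdsWithin_le_nhds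
      obtain ⟨ρ, h1, h2, h3, h4, h5⟩ := (eventually_mem_nhdsWithin.and
        ((t3.eventually_le_const (by norm_num : (0 : ℝ) < 1 / 2)).and
        ((t3.eventually_le_const hγ0).and ((t1.eventually_le_const hε).and
        (t2.eventually_ge_atTop R))))).exists
      exact ⟨ρ, h1, h2, h3, h4, h5⟩
    -- At this modulus `norm_mul_le` reads `‖r z n‖ ≤ ρ`.
    set z : ℂ := ((2 * B / ρ : ℝ) : ℂ) with hz
    have hzn : ‖z‖ = 2 * B / ρ := by
      rw [hz, Complex.norm_real, Real.norm_of_nonneg (by positivity)]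
    have hzR : R ≤ ‖z‖ := hzn ▸ hρ4
    have hrρ : ∀ n, ‖r z n‖ ≤ ρ := fun n => by
      have := (h z hzR).norm_mul_le hd (hr z hzR) n
      rw [hzn, div_mul_eq_mul_div, div_le_iff₀ hρ0] at this
      exact le_of_mul_le_mul_left this (by positivity)
    -- The zeroth term, of modulus at least `c`, dominates: `‖z * r z n‖ ≥ c / 2`.
    have hlow : ∀ᶠ n in atTop, γ * ρ ≤ ‖r z n‖ := by
      filter_upwards [hd0] with n hn
      have h1 := (h z hzR).norm_sub_sum_le hd hρ1 hrρ n 1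
      simp only [Finset.range_one, Finset.sum_singleton, Finset.prod_range_zero, mul_one,
        pow_one] at h1
      have h2 : c - 2 * B * ρ ≤ ‖z * r z n‖ := by
        have := norm_sub_norm_le (d 0 n) (z * r z n)
        rw [norm_sub_rev] at this
        linarith
      have h3 : 2 * B * ρ ≤ c / 2 := by
        calc 2 * B * ρ ≤ 2 * B * γ := by gcongr
          _ = c / 2 := by rw [hγ]; field_simp; norm_num
      have h4 : c / 2 ≤ 2 * B / ρ * ‖r z n‖ := by
        rw [norm_mul, hzn] at h2; linarith
      rw [div_mul_eq_mul_div, le_div_iff₀ hρ0] at h4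
      rw [hγ, div_mul_eq_mul_div, div_le_iff₀ (by positivity)]
      linarith
    obtain ⟨a, ha⟩ := hlim z hzR
    have hshift : ∀ i : ℕ, Tendsto (fun n : ℕ => n - i) atTop atTop := tendsto_sub_atTop_nat
    have hQ : ∀ j : ℕ, Tendsto (fun n => ∏ i ∈ Finset.range j, r z (n - i)) atTop (𝓝 (a ^ j)) := by
      intro j
      have := tendsto_finsetProd (Finset.range j) fun i _ => ha.comp (hshift i)
      simpa using this
    have hQlow : ∀ᶠ n in atTop, (γ * ρ) ^ k ≤ ‖∏ i ∈ Finset.range k, r z (n - i)‖ := by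
      have h1 : ∀ᶠ n in atTop, ∀ i ∈ Finset.range k, γ * ρ ≤ ‖r z (n - i)‖ :=
        (Finset.eventually_all _).2 fun i _ => (hshift i).eventually hlow
      filter_upwards [h1] with n hn
      rw [norm_prod]
      calc (γ * ρ) ^ k = ∏ i ∈ Finset.range k, γ * ρ := by simp
        _ ≤ _ := Finset.prod_le_prod (fun i _ => by positivity) hn
    have ha0 : a ^ k ≠ 0 := by
      have h1 := ge_of_tendsto (hQ k).norm hQlow
      have h2 : 0 < (γ * ρ) ^ k := by positivity
      exact norm_pos_iff.1 (h2.trans_le h1)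
    choose! b hb using ih
    -- The approximant is the recurrence solved for `d k n` with the terms beyond `k` dropped.
    refine ⟨fun n => (z * r z n - ∑ j ∈ Finset.range k, d j n * ∏ i ∈ Finset.range j, r z (n - i))
      / ∏ i ∈ Finset.range k, r z (n - i), ⟨_, ((ha.const_mul z).sub (tendsto_finsetSum _
        fun j hj => (hb j (Finset.mem_range.1 hj)).mul (hQ j))).div (hQ k) ha0⟩, ?_⟩
    filter_upwards [hQlow] with n hn
    have h1 := (h z hzR).norm_sub_sum_le hd hρ1 hrρ n (k + 1)
    rw [Finset.sum_range_succ, ← sub_sub] at h1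
    set Q := ∏ i ∈ Finset.range k, r z (n - i) with hQdef
    have hp : 0 < (γ * ρ) ^ k := by positivity
    have hQ0 : Q ≠ 0 := norm_pos_iff.1 (hp.trans_le hn)
    rw [norm_sub_rev, div_sub' hQ0, norm_div, mul_comm Q]
    refine le_trans ?_ hρ3
    -- The tail carries one more power of `ρ` than the divisor; this surplus makes the error at most
    -- `ε`.
    calc _ ≤ 2 * B * ρ ^ (k + 1) / (γ * ρ) ^ k := by gcongr
      _ = _ := by rw [mul_pow, pow_succ]; field_simp

/-- Convergence of the coefficients forces convergence of the solutions, uniformly far out. -/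
lemma uniformCauchySeqOn {r : ℂ → ℕ → ℂ} {S : Set ℂ} (hB : 0 < B)
    (hd : ∀ k n, ‖d k n‖ ≤ B) (hS : ∀ z ∈ S, 8 * B ≤ ‖z‖)
    (h : ∀ z ∈ S, SolvesRecurrence d z (r z))
    (hr : ∀ z ∈ S, ∀ n, ‖r z n‖ ≤ 1 / 2)
    (hlim : ∀ k, ∃ a, Tendsto (d k) atTop (𝓝 a)) :
    UniformCauchySeqOn (fun n z => r z n) atTop S := by
  -- `P ε` bounds by `ε` the eventual oscillation of the ratios, uniformly on `S`; one use of the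
  -- recurrence multiplies this bound by `3 / 4`.
  let P : ℝ → Prop := fun ε => ∃ N, ∀ m ≥ N, ∀ n ≥ N, ∀ z ∈ S, ‖r z m - r z n‖ ≤ ε
  have step : ∀ ε, 0 < ε → P ε → P (3 / 4 * ε) := by
    rintro ε hε ⟨N, hN⟩
    obtain ⟨K, hK⟩ : ∃ K : ℕ, (1 / 2 : ℝ) ^ K < ε / 4 :=
      exists_pow_lt_of_lt_one (by positivity) (by norm_num)
    have hcau : ∃ N', ∀ m ≥ N', ∀ n ≥ N', ∑ k ∈ Finset.range K, ‖d k m - d k n‖ ≤ B * ε := by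
      choose b hb using hlim
      have h1 : Tendsto (fun q : ℕ × ℕ => ∑ k ∈ Finset.range K, ‖d k q.1 - d k q.2‖)
          (atTop ×ˢ atTop) (𝓝 0) := by
        have := tendsto_finsetSum (Finset.range K) fun k _ =>
          (((hb k).comp tendsto_fst).sub ((hb k).comp tendsto_snd) :
            Tendsto (fun q : ℕ × ℕ => d k q.1 - d k q.2) (atTop ×ˢ atTop) _).norm
        simpa using this
      have h2 := h1.eventually_le_const (mul_pos hB hε)
      rw [prod_atTop_atTop_eq, eventually_atTop] at h2
      obtain ⟨q, hq⟩ := h2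
      exact ⟨max q.1 q.2, fun m hm n hn => hq (m, n)
        ⟨(le_max_left _ _).trans hm, (le_max_right _ _).trans hn⟩⟩
    obtain ⟨N', hN'⟩ := hcau
    -- Past `N + K`, all indices `m - i`, `n - i` with `i < K` still exceed `N`, where the old bound
    -- applies.
    refine ⟨max N' (N + K), fun m hm n hn z hz => ?_⟩
    have hm' : N + K ≤ m := (le_max_right _ _).trans hm
    have hn' : N + K ≤ n := (le_max_right _ _).trans hn
    have e1 := (h z hz).norm_sub_sum_le hd le_rfl (hr z hz) m K
    have e2 := (h z hz).norm_sub_sum_le hd le_rfl (hr z hz) n K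
    -- `B * ε` comes from the change in the coefficients, `4 * B * ε` from the change in the
    -- products, through `∑ k (1/2)^k ≤ 2`.
    have e3 : ‖∑ k ∈ Finset.range K, d k m * ∏ i ∈ Finset.range k, r z (m - i)
        - ∑ k ∈ Finset.range K, d k n * ∏ i ∈ Finset.range k, r z (n - i)‖
        ≤ B * ε + 4 * B * ε := by
      rw [← Finset.sum_sub_distrib]
      have hk : ∀ k ∈ Finset.range K, ‖d k m * ∏ i ∈ Finset.range k, r z (m - i)
          - d k n * ∏ i ∈ Finset.range k, r z (n - i)‖
          ≤ ‖d k m - d k n‖ + B * (2 * (k * (1 / 2) ^ k) * ε) := by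
        intro k hk
        have hkK := Finset.mem_range.1 hk
        have hQ := norm_prod_sub_prod_le (a := fun i => r z (m - i)) (b := fun i => r z (n - i))
          (k := k) (ε := ε) (fun i _ => hr z hz _) (fun i _ => hr z hz _)
          (fun i hi => hN _ (by omega) _ (by omega) z hz)
        have hQ1 : ‖∏ i ∈ Finset.range k, r z (m - i)‖ ≤ 1 :=
          (norm_prod_shift_le (hr z hz) m k).trans (pow_le_one₀ (by norm_num) (by norm_num))
        calc _ = ‖(d k m - d k n) * ∏ i ∈ Finset.range k, r z (m - i)
              + d k n * (∏ i ∈ Finset.range k, r z (m - i)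
                - ∏ i ∈ Finset.range k, r z (n - i))‖ := by ring_nf
          _ ≤ ‖d k m - d k n‖ * 1 + B * (2 * (k * (1 / 2) ^ k) * ε) := by
              refine (norm_add_le _ _).trans ?_
              rw [norm_mul, norm_mul]
              gcongr
              exact hd k n
          _ = _ := by rw [mul_one]
      refine (norm_sum_le _ _).trans ((Finset.sum_le_sum hk).trans ?_)
      rw [Finset.sum_add_distrib]
      have e4 : ∑ k ∈ Finset.range K, B * (2 * ((k : ℝ) * (1 / 2) ^ k) * ε)
          = 2 * B * ε * ∑ k ∈ Finset.range K, (k : ℝ) * (1 / 2) ^ k := by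
        rw [Finset.mul_sum]
        exact Finset.sum_congr rfl fun k _ => by ring
      rw [e4]
      have e5 : 2 * B * ε * ∑ k ∈ Finset.range K, (k : ℝ) * (1 / 2) ^ k ≤ 2 * B * ε * 2 :=
        mul_le_mul_of_nonneg_left (sum_mul_half_pow_le K) (by positivity)
      have e6 := hN' m ((le_max_left _ _).trans hm) n ((le_max_left _ _).trans hn)
      linarith
    -- Each of the two tails adds `B * ε / 2` to the `5 * B * ε` of `e3`; dividing `6 * B` by `8 *
    -- B` gives `3 / 4`.
    have e7 : ‖z‖ * ‖r z m - r z n‖ ≤ 6 * B * ε := by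
      rw [← norm_mul, mul_sub]
      have e8 : 2 * B * (1 / 2) ^ K ≤ 2 * B * (ε / 4) := by gcongr
      set s := ∑ k ∈ Finset.range K, d k m * ∏ i ∈ Finset.range k, r z (m - i)
      set t := ∑ k ∈ Finset.range K, d k n * ∏ i ∈ Finset.range k, r z (n - i)
      calc ‖z * r z m - z * r z n‖ = ‖(z * r z m - s) + (s - t) - (z * r z n - t)‖ := by ring_nf
        _ ≤ ‖z * r z m - s‖ + ‖s - t‖ + ‖z * r z n - t‖ :=
            (norm_sub_le _ _).trans (add_le_add_left (norm_add_le _ _) _)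
        _ ≤ _ := by linarith
    have e9 := mul_le_mul_of_nonneg_right (hS z hz) (norm_nonneg (r z m - r z n))
    have e10 : B * ‖r z m - r z n‖ ≤ B * (3 / 4 * ε) := by linarith
    exact le_of_mul_le_mul_left e10 hB
  have hP : ∀ j : ℕ, P ((3 / 4) ^ j) := by
    intro j
    induction j with
    | zero =>
      refine ⟨0, fun m _ n _ z hz => (norm_sub_le _ _).trans ?_⟩
      have h1 := hr z hz m
      have h2 := hr z hz n
      rw [pow_zero]; linarith
    | succ j ih => rw [pow_succ']; exact step _ (by positivity) ih
  rw [Metric.uniformCauchySeqOn_iff]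
  intro ε hε
  obtain ⟨j, hj⟩ := exists_pow_lt_of_lt_one hε (by norm_num : (3 / 4 : ℝ) < 1)
  obtain ⟨N, hN⟩ := hP j
  exact ⟨N, fun m hm n hn z hz => by
    rw [dist_eq_norm]; exact (hN m hm n hn z hz).trans_lt hj⟩

end SolvesRecurrence

/-! ### Hessenberg matrices and their recurrences -/

/-- Solutions of a Hessenberg recurrence grow geometrically at points of large modulus. -/
lemma hessenberg_growth {m : ℕ → ℕ → ℂ} {p : ℕ → ℂ} {z : ℂ} {B : ℝ}
    (hm : ∀ i j, ‖m i j‖ ≤ B) (hB : 0 < B) (hz : 4 * B ≤ ‖z‖) (hp0 : p 0 ≠ 0)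
    (hrec : ∀ n, z * p n = ∑ i ∈ Finset.range (n + 2), m i n * p i) (n : ℕ) :
    p n ≠ 0 ∧ 2 * ‖p n‖ ≤ ‖p (n + 1)‖ := by
  have key : ∀ n, ∑ i ∈ Finset.range (n + 1), ‖p i‖ ≤ 2 * ‖p n‖ → 2 * ‖p n‖ ≤ ‖p (n + 1)‖ := by
    intro n hn
    have h1 := hrec n
    rw [Finset.sum_range_succ] at h1
    have h2 : ‖∑ i ∈ Finset.range (n + 1), m i n * p i‖ ≤ B * (2 * ‖p n‖) := by
      refine (norm_sum_le _ _).trans (le_trans ?_ (mul_le_mul_of_nonneg_left hn hB.le))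
      rw [Finset.mul_sum]
      refine Finset.sum_le_sum fun i _ => ?_
      rw [norm_mul]
      exact mul_le_mul_of_nonneg_right (hm _ _) (norm_nonneg _)
    have h3 : ‖m (n + 1) n * p (n + 1)‖ ≤ B * ‖p (n + 1)‖ := by
      rw [norm_mul]
      exact mul_le_mul_of_nonneg_right (hm _ _) (norm_nonneg _)
    have h4 : ‖z‖ * ‖p n‖ ≤ B * (2 * ‖p n‖) + B * ‖p (n + 1)‖ := by
      rw [← norm_mul, h1]
      exact (norm_add_le _ _).trans (add_le_add h2 h3)
    have h5 := mul_le_mul_of_nonneg_right hz (norm_nonneg (p n))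
    have h6 : B * (2 * ‖p n‖) ≤ B * ‖p (n + 1)‖ := by linarith
    exact le_of_mul_le_mul_left h6 hB
  -- The induction carries the bound on the partial sums: doubling at each step keeps the sum below
  -- twice its last term.
  have hsum : ∀ n, p n ≠ 0 ∧ ∑ i ∈ Finset.range (n + 1), ‖p i‖ ≤ 2 * ‖p n‖ := by
    intro n
    induction n with
    | zero => exact ⟨hp0, by simp; linarith [norm_nonneg (p 0)]⟩
    | succ n ih =>
      have h1 := key n ih.2
      have h2 : 0 < ‖p n‖ := norm_pos_iff.2 ih.1
      refine ⟨norm_pos_iff.1 (by linarith), ?_⟩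
      rw [Finset.sum_range_succ]
      linarith [ih.2]
  exact ⟨(hsum n).1, key n (hsum n).2⟩

/-- The diagonals of a Hessenberg matrix, the subdiagonal being the zeroth one. -/
def diagonal (m : ℕ → ℕ → ℂ) (k n : ℕ) : ℂ := if k ≤ n + 1 then m (n + 1 - k) n else 0

lemma norm_diagonal_le {m : ℕ → ℕ → ℂ} {B : ℝ} (hm : ∀ i j, ‖m i j‖ ≤ B) (k n : ℕ) :
    ‖diagonal m k n‖ ≤ B := by
  rw [diagonal]
  split_ifs
  · exact hm _ _
  · rw [norm_zero]; exact (norm_nonneg _).trans (hm 0 0)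

/-- The products of ratios telescope to `p (n + 1 - k) / p (n + 1)`. The value `0` of `diagonal` for
`k > n + 1` makes the series finite and removes every term in which `n - i` would be truncated. -/
lemma solvesRecurrence_of_hessenberg {m : ℕ → ℕ → ℂ} {p : ℕ → ℂ} {z : ℂ} (hp : ∀ n, p n ≠ 0)
    (hrec : ∀ n, z * p n = ∑ i ∈ Finset.range (n + 2), m i n * p i) :
    SolvesRecurrence (diagonal m) z fun n => p n / p (n + 1) := by
  intro n
  have hprod : ∀ k ≤ n + 1, ∏ i ∈ Finset.range k, p (n - i) / p (n - i + 1)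
      = p (n + 1 - k) / p (n + 1) := by
    intro k
    induction k with
    | zero => intro _; simp [hp]
    | succ k ih =>
      intro hk
      rw [Finset.prod_range_succ, ih (by omega), show n - k + 1 = n + 1 - k by omega,
        show n + 1 - (k + 1) = n - k by omega]
      have := hp (n + 1 - k)
      field_simp
  have hval : z * (p n / p (n + 1)) = ∑ k ∈ Finset.range (n + 2),
      diagonal m k n * ∏ i ∈ Finset.range k, p (n - i) / p (n - i + 1) := by
    rw [← mul_div_assoc, hrec n, Finset.sum_div, ← Finset.sum_range_reflect]
    refine Finset.sum_congr rfl fun k hk => ?_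
    have hk' : k ≤ n + 1 := by have := Finset.mem_range.1 hk; omega
    rw [hprod k hk', diagonal, if_pos hk', show n + 2 - 1 - k = n + 1 - k by omega, mul_div_assoc]
  rw [hval]
  refine hasSum_sum_of_ne_finset_zero fun k hk => ?_
  have hk' : ¬ k ≤ n + 1 := by rw [Finset.mem_range] at hk; omega
  rw [diagonal, if_neg hk', zero_mul]

/-! ### Weak convergence in terms of matrix entries -/

/-- Finite sequences are dense in `ℓ²` and the functionals are uniformly bounded. The filter is
arbitrary so that differences indexed by `ℕ × ℕ` are covered, which yields the Cauchy version. -/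
lemma tendsto_zero_apply_of_stdVec {ι : Type*} {l : Filter ι} {u : ι → EllTwo →L[ℂ] ℂ} {C : ℝ}
    (hu : ∀ n, ‖u n‖ ≤ C) (h : ∀ j, Tendsto (fun n => u n (stdVec j)) l (𝓝 0)) (x : EllTwo) :
    Tendsto (fun n => u n x) l (𝓝 0) := by
  rcases isEmpty_or_nonempty ι with hι | ⟨⟨n₀⟩⟩
  · rw [Filter.filter_eq_bot_of_isEmpty l]; exact tendsto_bot
  have hC : 0 ≤ C := (norm_nonneg _).trans (hu n₀)
  have hx := lp.hasSum_single (p := 2) ENNReal.ofNat_ne_top x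
  have hfin : ∀ s : Finset ℕ, Tendsto (fun n => u n (∑ i ∈ s, lp.single 2 i (x i))) l (𝓝 0) := by
    intro s
    have he : ∀ n, u n (∑ i ∈ s, lp.single 2 i (x i)) = ∑ i ∈ s, x i * u n (stdVec i) := by
      intro n
      rw [map_sum]
      refine Finset.sum_congr rfl fun i _ => ?_
      rw [← smul_eq_mul, ← map_smul, stdVec, ← lp.single_smul, smul_eq_mul, mul_one]
    simp_rw [he]
    simpa using tendsto_finsetSum s fun i _ => (h i).const_mul (x i)
  rw [Metric.tendsto_nhds]
  intro ε hε
  have hδ : 0 < ε / (2 * (C + 1)) := by positivity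
  obtain ⟨s, hs⟩ := (Metric.tendsto_nhds.1 hx _ hδ).exists
  set y := ∑ i ∈ s, lp.single 2 i (x i) with hy
  filter_upwards [Metric.tendsto_nhds.1 (hfin s) (ε / 2) (by positivity)] with n hn
  rw [dist_comm, dist_eq_norm] at hs
  rw [dist_zero_right] at hn ⊢
  have hyx : ‖u n (x - y)‖ ≤ ε / 2 :=
    calc ‖u n (x - y)‖ ≤ ‖u n‖ * ‖x - y‖ := (u n).le_opNorm _
      _ ≤ (C + 1) * (ε / (2 * (C + 1))) := by gcongr; linarith [hu n]
      _ = ε / 2 := by field_simp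
  calc ‖u n x‖ = ‖u n (x - y) + u n y‖ := by rw [← map_add, sub_add_cancel]
    _ ≤ ‖u n (x - y)‖ + ‖u n y‖ := norm_add_le _ _
    _ < ε := by linarith

lemma cauchySeq_apply_of_stdVec {u : ℕ → EllTwo →L[ℂ] ℂ} {C : ℝ} (hu : ∀ n, ‖u n‖ ≤ C)
    (h : ∀ j, CauchySeq fun n => u n (stdVec j)) (x : EllTwo) : CauchySeq fun n => u n x := by
  have key := tendsto_zero_apply_of_stdVec (ι := ℕ × ℕ) (l := atTop)
    (u := fun q => u q.1 - u q.2) (C := C + C)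
    (fun q => (norm_sub_le _ _).trans (add_le_add (hu _) (hu _)))
    (fun j => by
      have := cauchySeq_iff_tendsto_dist_atTop_0.1 (h j)
      simp_rw [dist_eq_norm] at this
      exact tendsto_zero_iff_norm_tendsto_zero.2 this) x
  rw [cauchySeq_iff_tendsto_dist_atTop_0]
  simp_rw [dist_eq_norm]
  exact tendsto_zero_iff_norm_tendsto_zero.1 key

lemma inner_stdVec_left (i : ℕ) (x : EllTwo) : ⟪stdVec i, x⟫_ℂ = x i := by
  rw [stdVec, lp.inner_single_left]
  simp

/-- A bounded sequence of operators all of whose matrix entries converge is convergent in the weak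
operator topology. -/
lemma exists_tendsto_wot {A : ℕ → EllTwo →L[ℂ] EllTwo} {C : ℝ} (hA : ∀ n, ‖A n‖ ≤ C)
    {t : ℕ → ℕ → ℂ} (h : ∀ i j, Tendsto (fun n => entry (A n) i j) atTop (𝓝 (t i j))) :
    ∃ T : EllTwo →L[ℂ] EllTwo, (∀ i j, entry T i j = t i j) ∧
      Tendsto (fun n => ContinuousLinearMapWOT.ofCLM (A n)) atTop
        (𝓝 (ContinuousLinearMapWOT.ofCLM T)) := by
  have hC : 0 ≤ C := (norm_nonneg _).trans (hA 0)
  have hcoord : ∀ (x : EllTwo) (i : ℕ), CauchySeq fun n => A n x i := by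
    intro x i
    have hu : ∀ n, ‖(innerSL ℂ (stdVec i)) ∘L A n‖ ≤ ‖innerSL ℂ (stdVec i)‖ * C := fun n =>
      (ContinuousLinearMap.opNorm_comp_le _ _).trans (by gcongr; exact hA n)
    have := cauchySeq_apply_of_stdVec hu (fun j => (h i j).cauchySeq) x
    simpa [inner_stdVec_left] using this
  choose y hy using fun x i => cauchySeq_tendsto_of_complete (hcoord x i)
  have hbd : ∀ x n, ‖A n x‖ ≤ C * ‖x‖ := fun x n =>
    ((A n).le_opNorm x).trans (by gcongr; exact hA n)
  have hypi : ∀ x, Tendsto (id fun n => A n x : ℕ → ∀ _ : ℕ, ℂ) atTop (𝓝 (y x)) := fun x =>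
    tendsto_pi_nhds.2 (hy x)
  -- A coordinatewise limit of an `ℓ²`-bounded sequence stays in `ℓ²` with the same bound, as in
  -- Fatou's lemma.
  have hmem : ∀ x, Memℓp (y x) 2 := fun x =>
    lp.memℓp_of_tendsto (isBounded_iff_forall_norm_le.2
      ⟨C * ‖x‖, Set.forall_mem_range.2 (hbd x)⟩) (hypi x)
  let T : EllTwo →L[ℂ] EllTwo := LinearMap.mkContinuous
    { toFun := fun x => ⟨y x, hmem x⟩
      map_add' := fun x x' => by
        ext i
        refine tendsto_nhds_unique (hy (x + x') i) (((hy x i).add (hy x' i)).congr fun n => ?_)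
        rw [map_add]; rfl
      map_smul' := fun c x => by
        ext i
        refine tendsto_nhds_unique (hy (c • x) i) (((hy x i).const_mul c).congr fun n => ?_)
        rw [map_smul]; rfl } C fun x =>
      lp.norm_le_of_tendsto (Eventually.of_forall (hbd x)) (hypi x)
  have hT : ∀ x i, Tendsto (fun n => A n x i) atTop (𝓝 (T x i)) := hy
  refine ⟨T, fun i j => ?_, ?_⟩
  · refine tendsto_nhds_unique ?_ (h i j)
    simp_rw [entry, inner_stdVec_left]
    exact hT _ _
  rw [ContinuousLinearMapWOT.tendsto_iff_forall_inner_apply_tendsto]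
  intro x v
  change Tendsto (fun n => ⟪v, A n x⟫_ℂ) atTop (𝓝 ⟪v, T x⟫_ℂ)
  -- The varying vector sits in the conjugate-linear slot so that it defines functionals linear in
  -- `v`; conjugation restores the order afterwards.
  have hz : Tendsto (fun n => ⟪A n x - T x, v⟫_ℂ) atTop (𝓝 0) := by
    have hu : ∀ n, ‖innerSL ℂ (A n x - T x)‖ ≤ C * ‖x‖ + ‖T x‖ := fun n => by
      rw [innerSL_apply_norm]
      exact (norm_sub_le _ _).trans (by gcongr; exact hbd x n)
    have hstd : ∀ j, Tendsto (fun n => innerSL ℂ (A n x - T x) (stdVec j)) atTop (𝓝 0) := by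
      intro j
      have h1 := (continuous_star.tendsto _).comp ((hT x j).sub_const (T x j))
      rw [sub_self, star_zero] at h1
      refine h1.congr fun n => ?_
      rw [innerSL_apply_apply, ← inner_conj_symm, inner_stdVec_left]
      rfl
    exact tendsto_zero_apply_of_stdVec hu hstd v
  have h2 := (continuous_star.tendsto _).comp hz
  rw [star_zero] at h2
  have h3 : Tendsto (fun n => ⟪v, A n x⟫_ℂ - ⟪v, T x⟫_ℂ) atTop (𝓝 0) := by
    refine h2.congr fun n => ?_
    rw [← inner_sub_right]
    exact inner_conj_symm _ _
  simpa using h3.add_const ⟪v, T x⟫_ℂ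

/-! ### Conjugation by shifts and convergence along diagonals -/

lemma shiftR_stdVec (n : ℕ) : shiftR (stdVec n) = stdVec (n + 1) := by
  ext i
  change shiftSeq (stdVec n) i = stdVec (n + 1) i
  rw [stdVec, stdVec, lp.coeFn_single, lp.coeFn_single]
  cases i with
  | zero => simp [shiftSeq]
  | succ i => simp [shiftSeq, Pi.single_apply]

lemma shiftR_pow_stdVec (n j : ℕ) : (shiftR ^ n) (stdVec j) = stdVec (j + n) := by
  induction n with
  | zero => rfl
  | succ n ih => rw [pow_succ', mul_apply_eq_comp, ih, shiftR_stdVec]; rfl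

lemma shiftL_pow_apply (n i : ℕ) (x : EllTwo) : (shiftL ^ n) x i = x (i + n) := by
  induction n generalizing i with
  | zero => rfl
  | succ n ih =>
    rw [pow_succ', mul_apply_eq_comp]
    change (shiftL ^ n) x (i + 1) = _
    rw [ih, add_right_comm, add_assoc]

/-- Conjugation by the shifts moves the matrix up along its diagonals. -/
lemma entry_shift (A : EllTwo →L[ℂ] EllTwo) (n i j : ℕ) :
    entry ((shiftL ^ n) ∘L A ∘L (shiftR ^ n)) i j = entry A (i + n) (j + n) := by
  simp only [entry, inner_stdVec_left, ContinuousLinearMap.comp_apply, shiftR_pow_stdVec,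
    shiftL_pow_apply]

lemma norm_shift_le (A : EllTwo →L[ℂ] EllTwo) (n : ℕ) :
    ‖(shiftL ^ n) ∘L A ∘L (shiftR ^ n)‖ ≤ ‖A‖ := by
  have hpow : ∀ S : EllTwo →L[ℂ] EllTwo, ‖S‖ ≤ 1 → ‖S ^ n‖ ≤ 1 := fun S hS => by
    induction n with
    | zero => exact ContinuousLinearMap.norm_id_le
    | succ n ih =>
      rw [pow_succ]
      exact (norm_mul_le _ _).trans (mul_le_one₀ ih (norm_nonneg _) hS)
  have hL := hpow shiftL (LinearMap.mkContinuous_norm_le _ zero_le_one _)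
  have hR := hpow shiftR (LinearMap.mkContinuous_norm_le _ zero_le_one _)
  calc _ ≤ ‖shiftL ^ n‖ * (‖A‖ * ‖shiftR ^ n‖) :=
        (ContinuousLinearMap.opNorm_comp_le _ _).trans
          (by gcongr; exact ContinuousLinearMap.opNorm_comp_le _ _)
    _ ≤ 1 * (‖A‖ * 1) := by gcongr
    _ = ‖A‖ := by ring

lemma norm_entry_le (A : EllTwo →L[ℂ] EllTwo) (i j : ℕ) : ‖entry A i j‖ ≤ ‖A‖ := by
  have h : ∀ n, ‖stdVec n‖ = 1 := fun n => by rw [stdVec, lp.norm_single (by norm_num), norm_one]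
  calc ‖entry A i j‖ ≤ ‖stdVec i‖ * ‖A (stdVec j)‖ := norm_inner_le_norm _ _
    _ ≤ ‖stdVec i‖ * (‖A‖ * ‖stdVec j‖) := by gcongr; exact A.le_opNorm _
    _ = ‖A‖ := by rw [h, h]; ring

/-- For a Hessenberg matrix, being weakly asymptotically Toeplitz is convergence along each
diagonal. -/
lemma isWeaklyAsymptoticallyToeplitz_iff {A : EllTwo →L[ℂ] EllTwo}
    (hA : ∀ i j, j + 1 < i → entry A i j = 0) :
    IsWeaklyAsymptoticallyToeplitz A ↔
      ∀ k, ∃ a, Tendsto (diagonal (entry A) k) atTop (𝓝 a) := by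
  constructor
  · rintro ⟨T, -, hT⟩ k
    rw [ContinuousLinearMapWOT.tendsto_iff_forall_inner_apply_tendsto] at hT
    -- Row `1` meets every diagonal, the subdiagonal included at `k = 0`; row `0` would miss it.
    have h1 : Tendsto (fun n => entry ((shiftL ^ n) ∘L A ∘L (shiftR ^ n)) 1 k) atTop
        (𝓝 (entry T 1 k)) := hT (stdVec k) (stdVec 1)
    refine ⟨_, (tendsto_add_atTop_iff_nat k).1 (h1.congr fun n => ?_)⟩
    rw [entry_shift, diagonal, if_pos (by omega), add_comm 1, add_comm n k,
      show k + n + 1 - k = n + 1 by omega]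
  · intro h
    choose a ha using h
    -- The symbol at `l = j - i` is the limit along diagonal `l + 1`, since numbering starts at the
    -- subdiagonal `l = -1`.
    let t : ℤ → ℂ := fun l => if -1 ≤ l then a (l + 1).toNat else 0
    obtain ⟨T, hT, hlim⟩ := exists_tendsto_wot
      (A := fun n => (shiftL ^ n) ∘L A ∘L (shiftR ^ n)) (norm_shift_le A)
      (t := fun i j => t ((j : ℤ) - i)) (fun i j => by
        simp_rw [entry_shift]
        by_cases hij : i ≤ j + 1
        · have h1 : ((j : ℤ) - i + 1).toNat = j + 1 - i := by omega
          simp only [t, if_pos (show (-1 : ℤ) ≤ (j : ℤ) - i by omega), h1]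
          refine ((tendsto_add_atTop_iff_nat j).2 (ha (j + 1 - i))).congr fun n => ?_
          rw [diagonal, if_pos (by omega), add_comm n j,
            show j + n + 1 - (j + 1 - i) = i + n by omega]
        · simp only [t, if_neg (show ¬ (-1 : ℤ) ≤ (j : ℤ) - i by omega)]
          exact tendsto_const_nhds.congr fun n => (hA _ _ (by omega)).symm)
    exact ⟨T, ⟨t, hT⟩, hlim⟩

/-! ### The recurrence for the orthonormal polynomials -/

section

variable {μ : Measure ℂ} [IsFiniteMeasure μ]

lemma kappa_pos (hc : IsCompact μ.support) (hinf : μ.support.Infinite) (n : ℕ) :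
    0 < kappa μ n := by
  rw [kappa, ← norm_sq_polyLp hc, Real.sqrt_sq (norm_nonneg _), inv_pos, norm_pos_iff, ne_eq,
    (polyLp_injective hc hinf).eq_iff' (map_zero _)]
  exact (monic_monicPoly μ n).1.ne_zero

lemma orthoPoly_ne_zero (hc : IsCompact μ.support) (hinf : μ.support.Infinite) (n : ℕ) :
    orthoPoly μ n ≠ 0 := by
  rw [← leadingCoeff_ne_zero, leadingCoeff_orthoPoly]
  exact_mod_cast (kappa_pos hc hinf n).ne'

lemma natDegree_orthoPoly (hc : IsCompact μ.support) (hinf : μ.support.Infinite) (n : ℕ) :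
    (orthoPoly μ n).natDegree = n := by
  rw [orthoPoly, natDegree_C_mul (by exact_mod_cast (kappa_pos hc hinf n).ne'),
    (monic_monicPoly μ n).2]

lemma degree_orthoPoly (hc : IsCompact μ.support) (hinf : μ.support.Infinite) (n : ℕ) :
    (orthoPoly μ n).degree = n := by
  rw [degree_eq_natDegree (orthoPoly_ne_zero hc hinf n), natDegree_orthoPoly hc hinf]

lemma entry_bergmanShift_eq_inner (hc : IsCompact μ.support) (hinf : μ.support.Infinite)
    (i j : ℕ) : entry (bergmanShift hc hinf) i j
      = ⟪polyLp hc (orthoPoly μ i), polyLp hc (X * orthoPoly μ j)⟫_ℂ := by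
  rw [entry_bergmanShift, inner_polyLp]
  simp

lemma mem_span_orthoPoly (hc : IsCompact μ.support) (hinf : μ.support.Infinite) {p : ℂ[X]} {n : ℕ}
    (hp : p.degree < (n : WithBot ℕ)) :
    p ∈ Submodule.span ℂ (orthoPoly μ '' (Finset.range n : Set ℕ)) := by
  let S : Polynomial.Sequence ℂ := ⟨orthoPoly μ, degree_orthoPoly hc hinf⟩
  have h := S.span_degreeLT (m := n) fun i _ => (leadingCoeff_ne_zero.2 (S.ne_zero i)).isUnit
  rw [Finset.coe_range]
  change p ∈ Submodule.span ℂ (S '' Set.Iio n)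
  rw [h, mem_degreeLT]
  exact hp

/-- Expansion of `z φ_n` in the orthonormal polynomials. -/
lemma X_mul_orthoPoly (hc : IsCompact μ.support) (hinf : μ.support.Infinite) (n : ℕ) :
    X * orthoPoly μ n = ∑ i ∈ Finset.range (n + 2),
      C (entry (bergmanShift hc hinf) i n) * orthoPoly μ i := by
  have hdeg : (X * orthoPoly μ n).degree < ((n + 2 : ℕ) : WithBot ℕ) := by
    rw [degree_mul, degree_X, degree_orthoPoly hc hinf]
    rw [add_comm]
    exact_mod_cast Nat.lt_succ_self (n + 1)
  obtain ⟨c, hc'⟩ := (Submodule.mem_span_image_finset_iff_exists_fun' ℂ).1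
    (mem_span_orthoPoly hc hinf hdeg)
  have hcoef : ∀ i ∈ Finset.range (n + 2), entry (bergmanShift hc hinf) i n = c i := by
    intro i hi
    rw [entry_bergmanShift_eq_inner, ← hc', map_sum]
    simp_rw [map_smul]
    exact (orthonormal_orthoPoly hc hinf).inner_right_sum c hi
  rw [← hc']
  exact Finset.sum_congr rfl fun i hi => by rw [hcoef i hi, C_mul']

lemma entry_bergmanShift_eq_zero (hc : IsCompact μ.support) (hinf : μ.support.Infinite) {i j : ℕ}
    (hij : j + 1 < i) : entry (bergmanShift hc hinf) i j = 0 := by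
  rw [entry_bergmanShift_eq_inner, X_mul_orthoPoly hc hinf, map_sum, inner_sum]
  refine Finset.sum_eq_zero fun k hk => ?_
  have hk' := Finset.mem_range.1 hk
  rw [C_mul', map_smul, inner_smul_right, (orthonormal_orthoPoly hc hinf).2 (by omega), mul_zero]

/-- Only `φ_{n+1}` contributes to the coefficient of `z^(n+1)` in the expansion of `z φ_n`. The
assumption on `κ_n/κ_{n+1}` thereby becomes a lower bound on the subdiagonal. -/
lemma entry_bergmanShift_succ (hc : IsCompact μ.support) (hinf : μ.support.Infinite) (n : ℕ) :
    entry (bergmanShift hc hinf) (n + 1) n = (kappa μ n / kappa μ (n + 1) : ℝ) := by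
  have h := congrArg (fun p : ℂ[X] => p.coeff (n + 1)) (X_mul_orthoPoly hc hinf n)
  have hlead : ∀ m, (orthoPoly μ m).coeff m = kappa μ m := fun m => by
    rw [← leadingCoeff_orthoPoly, leadingCoeff, natDegree_orthoPoly hc hinf]
  simp only [coeff_X_mul, finsetSum_coeff, coeff_C_mul] at h
  rw [Finset.sum_range_succ, Finset.sum_eq_zero, zero_add, hlead, hlead] at h
  · have h0 : (kappa μ (n + 1) : ℂ) ≠ 0 := by exact_mod_cast (kappa_pos hc hinf _).ne'
    rw [Complex.ofReal_div, h, mul_div_cancel_right₀ _ h0]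
  · intro i hi
    rw [coeff_eq_zero_of_natDegree_lt, mul_zero]
    rw [natDegree_orthoPoly hc hinf]
    exact Finset.mem_range.1 hi

lemma norm_bergmanShift_pos (hc : IsCompact μ.support) (hinf : μ.support.Infinite) :
    0 < ‖bergmanShift hc hinf‖ := by
  refine lt_of_lt_of_le ?_ (norm_entry_le _ 1 0)
  rw [entry_bergmanShift_succ hc hinf 0, norm_pos_iff]
  exact_mod_cast (div_pos (kappa_pos hc hinf _) (kappa_pos hc hinf _)).ne'

lemma mul_eval_orthoPoly (hc : IsCompact μ.support) (hinf : μ.support.Infinite) (z : ℂ) (n : ℕ) :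
    z * (orthoPoly μ n).eval z = ∑ i ∈ Finset.range (n + 2),
      entry (bergmanShift hc hinf) i n * (orthoPoly μ i).eval z := by
  have h := congrArg (eval z) (X_mul_orthoPoly hc hinf n)
  simpa [eval_finsetSum] using h

lemma eval_orthoPoly_growth (hc : IsCompact μ.support) (hinf : μ.support.Infinite) {z : ℂ}
    (hz : 4 * ‖bergmanShift hc hinf‖ ≤ ‖z‖) (n : ℕ) : (orthoPoly μ n).eval z ≠ 0 ∧
      2 * ‖(orthoPoly μ n).eval z‖ ≤ ‖(orthoPoly μ (n + 1)).eval z‖ := by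
  refine hessenberg_growth (p := fun n => (orthoPoly μ n).eval z) (norm_entry_le _)
    (norm_bergmanShift_pos hc hinf) hz ?_ (mul_eval_orthoPoly hc hinf z) n
  have h0 : orthoPoly μ 0 = C ((orthoPoly μ 0).coeff 0) :=
    eq_C_of_natDegree_eq_zero (natDegree_orthoPoly hc hinf 0)
  intro h
  apply orthoPoly_ne_zero hc hinf 0
  change eval z (orthoPoly μ 0) = 0 at h
  rw [h0, eval_C] at h
  rw [h0, h, C_0]

/-- The ratio `φ_n(z) / φ_{n+1}(z)`. -/
noncomputable def orthoRatio (μ : Measure ℂ) (z : ℂ) (n : ℕ) : ℂ :=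
  (orthoPoly μ n).eval z / (orthoPoly μ (n + 1)).eval z

lemma norm_orthoRatio_le (hc : IsCompact μ.support) (hinf : μ.support.Infinite) {z : ℂ}
    (hz : 4 * ‖bergmanShift hc hinf‖ ≤ ‖z‖) (n : ℕ) : ‖orthoRatio μ z n‖ ≤ 1 / 2 := by
  have h1 := (eval_orthoPoly_growth hc hinf hz n).2
  have h2 := norm_pos_iff.2 (eval_orthoPoly_growth hc hinf hz (n + 1)).1
  rw [orthoRatio, norm_div, div_le_iff₀ h2]
  linarith

lemma solvesRecurrence_orthoRatio (hc : IsCompact μ.support) (hinf : μ.support.Infinite) {z : ℂ}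
    (hz : 4 * ‖bergmanShift hc hinf‖ ≤ ‖z‖) :
    SolvesRecurrence (diagonal (entry (bergmanShift hc hinf))) z (orthoRatio μ z) :=
  solvesRecurrence_of_hessenberg (fun n => (eval_orthoPoly_growth hc hinf hz n).1)
    (mul_eval_orthoPoly hc hinf z)

/-! ### The two implications -/

lemma exists_tendsto_diagonal (hc : IsCompact μ.support) (hinf : μ.support.Infinite)
    (hκ : 0 < liminf (fun n : ℕ => kappa μ n / kappa μ (n + 1)) atTop)
    (h : HasRatioAsymptotics μ) (k : ℕ) :
    ∃ a, Tendsto (diagonal (entry (bergmanShift hc hinf)) k) atTop (𝓝 a) := by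
  obtain ⟨R, -, f, -, hf⟩ := h
  obtain ⟨c, hc0, hcκ⟩ := exists_between hκ
  have hbdd : IsBoundedUnder (· ≥ ·) atTop fun n : ℕ => kappa μ n / kappa μ (n + 1) :=
    isBoundedUnder_of ⟨0, fun n => (div_pos (kappa_pos hc hinf _) (kappa_pos hc hinf _)).le⟩
  set B := ‖bergmanShift hc hinf‖ with hB
  have h4 : ∀ z : ℂ, max (R + 1) (4 * B) ≤ ‖z‖ → 4 * B ≤ ‖z‖ := fun z hz =>
    (le_max_right _ _).trans hz
  -- `R + 1` turns the non-strict condition on `‖z‖` into the strict one defining `nearInfty R`; `4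
  -- * B` ensures growth.
  refine SolvesRecurrence.exists_tendsto_coeff (r := orthoRatio μ) (R := max (R + 1) (4 * B))
    (norm_bergmanShift_pos hc hinf) hc0 (norm_diagonal_le (norm_entry_le _)) ?_
    (fun z hz => solvesRecurrence_orthoRatio hc hinf (h4 z hz))
    (fun z hz => norm_orthoRatio_le hc hinf (h4 z hz)) (fun z hz => ⟨f z, ?_⟩) k
  · filter_upwards [eventually_lt_of_lt_liminf hcκ hbdd] with n hn
    rw [diagonal, if_pos (Nat.zero_le _), Nat.sub_zero, entry_bergmanShift_succ hc hinf,
      Complex.norm_real]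
    exact hn.le.trans (le_abs_self _)
  · have hzR : R < ‖z‖ := by linarith [(le_max_left (R + 1) (4 * B)).trans hz]
    exact hf z (Or.inr ⟨z, hzR, rfl⟩)

lemma hasRatioAsymptotics_of_tendsto_diagonal (hc : IsCompact μ.support)
    (hinf : μ.support.Infinite)
    (h : ∀ k, ∃ a, Tendsto (diagonal (entry (bergmanShift hc hinf)) k) atTop (𝓝 a)) :
    HasRatioAsymptotics μ := by
  set B := ‖bergmanShift hc hinf‖ with hBdef
  have hB : 0 < B := norm_bergmanShift_pos hc hinf
  set S : Set ℂ := {z | 8 * B < ‖z‖} with hS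
  have hSopen : IsOpen S := isOpen_lt continuous_const continuous_norm
  have h4 : ∀ z ∈ S, 4 * B ≤ ‖z‖ := fun z hz => by
    have : 8 * B < ‖z‖ := hz
    linarith
  have hcau : UniformCauchySeqOn (fun n z => orthoRatio μ z n) atTop S :=
    SolvesRecurrence.uniformCauchySeqOn hB (norm_diagonal_le (norm_entry_le _))
      (fun z hz => le_of_lt hz) (fun z hz => solvesRecurrence_orthoRatio hc hinf (h4 z hz))
      (fun z hz => norm_orthoRatio_le hc hinf (h4 z hz)) h
  have hex : ∀ z ∈ S, ∃ a, Tendsto (orthoRatio μ z) atTop (𝓝 a) := fun z hz =>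
    cauchySeq_tendsto_of_complete (hcau.cauchySeq hz)
  choose! g hg using hex
  have hunif := hcau.tendstoUniformlyOn_of_tendsto hg
  have hdiff : DifferentiableOn ℂ g S := by
    refine hunif.tendstoLocallyUniformlyOn.differentiableOn (Eventually.of_forall fun n => ?_) hSopen
    exact (orthoPoly μ n).differentiable.differentiableOn.div
      (orthoPoly μ (n + 1)).differentiable.differentiableOn
      fun z hz => (eval_orthoPoly_growth hc hinf (h4 z hz) (n + 1)).1
  -- The decay of the ratios passes to the limit and gives continuity at infinity with value `0`.
  have hgbd : ∀ z ∈ S, ‖z‖ * ‖g z‖ ≤ 2 * B := fun z hz =>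
    le_of_tendsto ((hg z hz).norm.const_mul ‖z‖) (Eventually.of_forall fun n =>
      (solvesRecurrence_orthoRatio hc hinf (h4 z hz)).norm_mul_le
        (norm_diagonal_le (norm_entry_le _)) (norm_orthoRatio_le hc hinf (h4 z hz)) n)
  refine ⟨8 * B, by positivity, fun z => z.elim 0 g,
    ⟨hdiff.analyticOnNhd hSopen, ?_⟩, ?_⟩
  · change AnalyticAt ℂ (fun w : ℂ => if w = 0 then 0 else g w⁻¹) 0
    have hinv : ∀ w : ℂ, w ∈ Metric.ball (0 : ℂ) (8 * B)⁻¹ → w ≠ 0 → w⁻¹ ∈ S := by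
      intro w hw hw0
      rw [mem_ball_zero_iff] at hw
      change 8 * B < ‖w⁻¹‖
      rw [norm_inv]
      exact (lt_inv_comm₀ (by positivity) (norm_pos_iff.2 hw0)).2 hw
    have hball : Metric.ball (0 : ℂ) (8 * B)⁻¹ ∈ 𝓝 (0 : ℂ) :=
      Metric.ball_mem_nhds _ (by positivity)
    -- Removable singularity at `w = 0` in the chart `w = 1/z`.
    apply Complex.analyticAt_of_differentiable_on_punctured_nhds_of_continuousAt
    · filter_upwards [mem_nhdsWithin_of_mem_nhds hball, self_mem_nhdsWithin] with w hw hw0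
      have h1 : DifferentiableAt ℂ (fun w : ℂ => g w⁻¹) w :=
        ((hdiff _ (hinv w hw hw0)).differentiableAt (hSopen.mem_nhds (hinv w hw hw0))).comp w
          (differentiableAt_inv hw0)
      refine h1.congr_of_eventuallyEq ?_
      filter_upwards [isOpen_ne.mem_nhds hw0] with v hv using if_neg hv
    · rw [ContinuousAt, if_pos rfl]
      refine squeeze_zero_norm' (a := fun w : ℂ => 2 * B * ‖w‖) ?_ ?_
      · filter_upwards [hball] with w hw
        by_cases hw0 : w = 0
        · simp [hw0]
        · have h1 := hgbd _ (hinv w hw hw0)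
          rw [if_neg hw0]
          rwa [norm_inv, inv_mul_le_iff₀ (norm_pos_iff.2 hw0), mul_comm] at h1
      · have : Continuous fun w : ℂ => 2 * B * ‖w‖ := by fun_prop
        simpa using this.tendsto 0
  · rintro z (rfl | ⟨z, hz, rfl⟩)
    · refine tendsto_const_nhds.congr fun n => (ratioAt_infty ?_).symm
      rw [degree_orthoPoly hc hinf, degree_orthoPoly hc hinf]
      exact_mod_cast n.lt_succ_self
    · exact hg z hz

end

end OrthPoly

theorem corollary1p3 (μ : Measure ℂ) [IsFiniteMeasure μ]
    (hc : IsCompact μ.support) (hinf : μ.support.Infinite)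
    (hκ : 0 < liminf (fun n : ℕ => kappa μ n / kappa μ (n + 1)) atTop) :
    HasRatioAsymptotics μ ↔ IsWeaklyAsymptoticallyToeplitz (bergmanShift hc hinf) := by
  rw [isWeaklyAsymptoticallyToeplitz_iff fun i j => entry_bergmanShift_eq_zero hc hinf]
  exact ⟨exists_tendsto_diagonal hc hinf hκ, hasRatioAsymptotics_of_tendsto_diagonal hc hinf⟩
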